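/- Let $d\ge 1$, $\lambda>0$, let $u:\mathbb Z^d\to\mathbb R$ and let $\mu$ be a probability measure on $\mathbb R$ with a bounded density $\rho$ that vanishes outside $[-1,1]$. Let $\mathbb P=\bigotimes_{k\in\mathbb Z^d}\mu$ on $\mathbb R^{\mathbb Z^d}$, so that the coordinates $\omega_k$ are i.i.d. with law $\mu$. For $x\in\mathbb Z^d$ and $L>0$ let $\Lambda_{L,x}=\{k\in\mathbb Z^d:|x-k|_\infty\le L\}$ and $\Lambda_L=\Lambda_{L,0}$. Consider the discrete alloy-type operator $H_\omega=-\Delta+\lambda V_\omega$, where $$(\Delta\psi)(x)=\sum_{|e|_1=1}\psi(x+e),\qquad V_\omega(x)=\sum_{k\in\mathbb Z^d}\omega_k\,u(x-k).$$ For finite $\Gamma\subset\mathbb Z^d$ let $H_{\omega,\Gamma}$ be the compression of $H_\omega$ to $\ell^2(\Gamma)$ (the matrix $(\langle\delta_x,H_\omega\delta_y\rangle)_{x,y\in\Gamma}$), and write $H_{\omega,L}=H_{\omega,\Lambda_L}$. Let $\|(H_{\omega,\Gamma}-E)^{-1}\|$ denote the operator norm, which is $+\infty$ if $E$ is an eigenvalue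 of $H_{\omega,\Gamma}$ and $0$ if $\Gamma=\emptyset$. Let $A_0>1$. Then there are constants $\delta>0$ and $C>0$, depending only on $d,\lambda,u,\mu,A_0$, such that the following holds for all $E\in\mathbb R$, $L>0$, $r\ge1$ and $A\ge A_0$. Assume 1. for $\mathbb P$-almost every $\omega$ there is $n\in\Lambda_L$ with $\|(H_{\omega,\Lambda_L\setminus\Lambda_{r,n}}-E)^{-1}\|\le A$; 2. for $\mathbb P$-almost every $\omega$ and every $n\in\Lambda_L$ there is $\tilde\omega\in\mathbb R^{\mathbb Z^d}$ with $\tilde\omega_m=\omega_m$ for all $m\ne n$, with $\tilde\omega_n\in[-1,1]$, and with $\|(H_{\tilde\omega,L}-E)^{-1}\|\le A$; 3. $\operatorname{supp}u\subset\Lambda_r$. Then for all $s\in\mathbb R$ $$\mathbb P\{\|(H_{\omega,L}-E)^{-1}\|\ge e^{s}\}\le C\,(2L+1)^d\,e^{-\frac{\delta s}{\log(A)\, r^d}},$$ and for all $s\ge C\,r^d\log(A)\log(L+2)$ $$\mathbb P\{\|(H_{\omega,L}-E)^{-1}\|\ge e^{s}\}\le e^{-\frac{\delta s}{\log(A)\,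 r^d}}.$$ -/

import Mathlib

open MeasureTheory

noncomputable section

namespace AlloyType

/-- The cube `Λ_{L,x} = {k ∈ ℤ^d : |x - k|_∞ ≤ L}`, see `mem_cube`. -/
def cube {d : ℕ} (L : ℝ) (x : Fin d → ℤ) : Finset (Fin d → ℤ) :=
  Finset.Icc (fun i => x i - ⌊L⌋) (fun i => x i + ⌊L⌋)

theorem mem_cube {d : ℕ} (L : ℝ) (x k : Fin d → ℤ) :
    k ∈ cube L x ↔ ∀ i, |((x i - k i : ℤ) : ℝ)| ≤ L := by
  have key : ∀ i, (|((x i - k i : ℤ) : ℝ)| ≤ L ↔ (x i - ⌊L⌋ ≤ k i ∧ k i ≤ x i + ⌊L⌋)) := by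
    intro i
    rw [← Int.cast_abs, ← Int.le_floor, abs_le]
    constructor <;> rintro ⟨h1, h2⟩ <;> constructor <;> omega
  simp only [cube, Finset.mem_Icc, Pi.le_def, key, forall_and]

/-- The alloy-type potential `V_ω(x) = ∑_{k ∈ ℤ^d} ω_k u(x - k)`. -/
def potential {d : ℕ} (u ω : (Fin d → ℤ) → ℝ) (x : Fin d → ℤ) : ℝ :=
  ∑' k : Fin d → ℤ, ω k * u (x - k)

/-- The discrete Laplacian `(Δψ)(x) = ∑_{|e|₁ = 1} ψ(x + e)` (the vectors `e ∈ ℤ^d` with `|e|₁ = 1`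
are plus and minus the standard unit vectors). -/
def laplacian {d : ℕ} (ψ : (Fin d → ℤ) → ℂ) (x : Fin d → ℤ) : ℂ :=
  ∑ i : Fin d, (ψ (x + Pi.single i 1) + ψ (x - Pi.single i 1))

/-- The Schrödinger operator `H_ω = -Δ + lam V_ω`, acting on functions on `ℤ^d`. -/
def hamiltonian {d : ℕ} (lam : ℝ) (u ω : (Fin d → ℤ) → ℝ) (ψ : (Fin d → ℤ) → ℂ)
    (x : Fin d → ℤ) : ℂ :=
  -laplacian ψ x + (lam : ℂ) * (potential u ω x : ℂ) * ψ x

/-- The restriction `H_{ω,Γ}` of `H_ω` to `ℓ²(Γ)`, for a finite set `Γ`, as the matrix with entries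
`⟨δ_x, H_ω δ_y⟩`, `x, y ∈ Γ`. -/
def boxHamiltonian {d : ℕ} (lam : ℝ) (u ω : (Fin d → ℤ) → ℝ) (Γ : Finset (Fin d → ℤ)) :
    Matrix Γ Γ ℂ :=
  Matrix.of fun x y => hamiltonian lam u ω (Pi.single (y : Fin d → ℤ) 1) x

open Classical in
/-- The operator norm on `ℓ²(Γ)` of the resolvent `(H_{ω,Γ} - E)⁻¹`, which is `∞` if `E` is in the
spectrum of `H_{ω,Γ}`. -/
def resolventNorm {d : ℕ} (lam : ℝ) (u ω : (Fin d → ℤ) → ℝ) (Γ : Finset (Fin d → ℤ)) (E : ℝ) :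
    ENNReal :=
  if IsUnit (boxHamiltonian lam u ω Γ - (E : ℂ) • (1 : Matrix Γ Γ ℂ)) then
    ENNReal.ofReal
      ‖Matrix.toEuclideanCLM (n := Γ) (𝕜 := ℂ)
        (boxHamiltonian lam u ω Γ - (E : ℂ) • (1 : Matrix Γ Γ ℂ))⁻¹‖
  else ⊤

/-- The law of an i.i.d. family `(ω_k)`, `k ∈ ℤ^d`, with common distribution `μ`. -/
def iidLaw (d : ℕ) (μ : Measure ℝ) [IsProbabilityMeasure μ] : Measure ((Fin d → ℤ) → ℝ) :=
  Measure.infinitePi fun _ : Fin d → ℤ => μ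

/-- For almost every `ω` some `n ∈ Λ_L` is such that the resolvent on `Λ_L` without the
cube `Λ_{r,n}` is bounded by `A`. -/
def RemovalBound {d : ℕ} (lam : ℝ) (u : (Fin d → ℤ) → ℝ) (μ : Measure ℝ) [IsProbabilityMeasure μ]
    (E L r A : ℝ) : Prop :=
  ∀ᵐ ω ∂(iidLaw d μ), ∃ n ∈ cube L (0 : Fin d → ℤ),
    resolventNorm lam u ω (cube L 0 \ cube r n) E ≤ ENNReal.ofReal A

/-- For almost every `ω` and every `n ∈ Λ_L`, one can change `ω` at the single site `n`, to a value
in `[-1, 1]`, so that the resolvent on `Λ_L` becomes bounded by `A`. -/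
def ModificationBound {d : ℕ} (lam : ℝ) (u : (Fin d → ℤ) → ℝ) (μ : Measure ℝ)
    [IsProbabilityMeasure μ] (E L A : ℝ) : Prop :=
  ∀ᵐ ω ∂(iidLaw d μ), ∀ n ∈ cube L (0 : Fin d → ℤ),
    ∃ ω' : (Fin d → ℤ) → ℝ, (∀ m, m ≠ n → ω' m = ω m) ∧ ω' n ∈ Set.Icc (-1 : ℝ) 1 ∧
      resolventNorm lam u ω' (cube L 0) E ≤ ENNReal.ofReal A

end AlloyType

end

/-! Freeze every coordinate except `ω 0`, for which the modification hypothesis supplies `t₀ ∈ [-1,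
1]` with resolvent at most `A`. Moving this coordinate from `t₀` to `t` adds `t - t₀` times a fixed
diagonal matrix supported on `Λ_r`, of rank at most `N = |Λ_r|`. The Woodbury formula then reduces
the new inverse to that of a matrix `1 + (t - t₀) Q` of size at most `N`, with `‖Q‖ ≤ const · A`
(`exists_norm_inv_add_diagonal_le`). Bounding that inverse through its determinant, a resolvent
above `exp s` forces the determinant below `(const · A)^(3N) exp (-s)`.

The determinant is a polynomial in `t` of degree at most `N` with value 1 at `t₀`, so it is small
only on a small set: each factor dominates a truncated distance to a real point, and integrability
of `|y|^(-1/2)` with Hölder and Markov gives measure at most `6 η^(1/(2N))`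
(`volume_prod_min_abs_sub_le`). The bounded density and Fubini turn this into a probability at most
`const · A^(3/2) exp (-s/(2N))`, where `N ≤ 3^d r^d`.

Finally `p ≤ p^θ` with `θ` of order `1 / log A` makes `A^(3/2)` a constant and puts `log A` into the
rate. No volume factor arises, so the first bound is immediate from `(2L+1)^d ≥ 1`; the second gives
up half the rate to absorb the constant. -/

namespace AlloyType

/-! ### Inverses, determinants and finite-rank perturbations of matrices -/

open scoped Matrix.Norms.L2Operator in
/-- The norm of the inverse of a Hermitian matrix is bounded by any bound on the inverses of its
eigenvalues. -/
theorem norm_inv_le_of_eigenvalues {n : Type*} [Fintype n] [DecidableEq n] {H : Matrix n n ℂ}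
    (hH : H.IsHermitian) {q : ℝ} (hq : 0 ≤ q) (h0 : ∀ i, hH.eigenvalues i ≠ 0)
    (h : ∀ i, |(hH.eigenvalues i)⁻¹| ≤ q) : ‖H⁻¹‖ ≤ q := by
  have key : H⁻¹ = (hH.eigenvectorUnitary : Matrix n n ℂ) *
      Matrix.diagonal (fun i => ((hH.eigenvalues i)⁻¹ : ℂ)) *
      ((star hH.eigenvectorUnitary : unitary (Matrix n n ℂ)) : Matrix n n ℂ) := by
    apply Matrix.inv_eq_right_inv
    have hs := hH.spectral_theorem
    rw [Unitary.conjStarAlgAut_apply] at hs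
    have e1 : (star (hH.eigenvectorUnitary : Matrix n n ℂ)) *
        (hH.eigenvectorUnitary : Matrix n n ℂ) = 1 := Unitary.coe_star_mul_self _
    have e2 : (hH.eigenvectorUnitary : Matrix n n ℂ) *
        (star (hH.eigenvectorUnitary : Matrix n n ℂ)) = 1 := Unitary.coe_mul_star_self _
    have e3 : Matrix.diagonal (RCLike.ofReal ∘ hH.eigenvalues) *
        Matrix.diagonal (fun i => ((hH.eigenvalues i)⁻¹ : ℂ)) = 1 := by
      rw [Matrix.diagonal_mul_diagonal, ← Matrix.diagonal_one]
      congr 1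
      ext i
      exact mul_inv_cancel₀ (Complex.ofReal_ne_zero.2 (h0 i))
    rw [Unitary.coe_star]
    calc _ = ((hH.eigenvectorUnitary : Matrix n n ℂ) *
          Matrix.diagonal (RCLike.ofReal ∘ hH.eigenvalues) *
          star (hH.eigenvectorUnitary : Matrix n n ℂ)) * _ := congrArg (· * _) hs
      _ = (hH.eigenvectorUnitary : Matrix n n ℂ) *
          (Matrix.diagonal (RCLike.ofReal ∘ hH.eigenvalues) *
            ((star (hH.eigenvectorUnitary : Matrix n n ℂ)) *
              (hH.eigenvectorUnitary : Matrix n n ℂ)) *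
            Matrix.diagonal (fun i => ((hH.eigenvalues i)⁻¹ : ℂ))) *
          star (hH.eigenvectorUnitary : Matrix n n ℂ) := by
            simp only [Matrix.mul_assoc]
      _ = 1 := by rw [e1, Matrix.mul_one, e3, Matrix.mul_one, e2]
  rw [key, CStarRing.norm_mul_coe_unitary, CStarRing.norm_coe_unitary_mul,
    Matrix.l2_opNorm_diagonal, pi_norm_le_iff_of_nonneg hq]
  intro i
  rw [← Complex.ofReal_inv, Complex.norm_real]
  exact h i

open scoped Matrix.Norms.L2Operator in
theorem eigenvalues_le_norm {n : Type*} [Fintype n] [DecidableEq n] {H : Matrix n n ℂ}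
    (hH : H.IsHermitian) (i : n) : |hH.eigenvalues i| ≤ ‖H‖ := by
  have h := Matrix.l2_opNorm_mulVec H (hH.eigenvectorBasis i)
  rw [hH.mulVec_eigenvectorBasis i] at h
  have e : (EuclideanSpace.equiv n ℂ).symm
      (hH.eigenvalues i • (hH.eigenvectorBasis i).ofLp) =
      hH.eigenvalues i • hH.eigenvectorBasis i := rfl
  rw [e, norm_smul, OrthonormalBasis.norm_eq_one, mul_one, mul_one, Real.norm_eq_abs] at h
  exact h

open scoped Matrix.Norms.L2Operator ComplexOrder in
/-- The inverse of an `n × n` matrix of norm at most `c ≥ 1` has norm at most `cⁿ / |det M|`. -/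
theorem norm_inv_le_pow_div_det {n : Type*} [Fintype n] [DecidableEq n] (M : Matrix n n ℂ)
    {c : ℝ} (hc : 1 ≤ c) (hM : ‖M‖ ≤ c) (hdet : M.det ≠ 0) :
    ‖M⁻¹‖ ≤ c ^ Fintype.card n / ‖M.det‖ := by
  have hU : IsUnit M := (Matrix.isUnit_iff_isUnit_det M).2 (isUnit_iff_ne_zero.2 hdet)
  -- The eigenvalues of `H` are the squared singular values of `M`; each lies in `(0, c²]` and their
  -- product is `|det M|²`, which bounds the smallest from below.
  set H := M.conjTranspose * M with hHdef
  have hpd : H.PosDef := Matrix.PosDef.conjTranspose_mul_self M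
    (Matrix.mulVec_injective_of_isUnit hU)
  have hH := hpd.isHermitian
  have hpos := hpd.eigenvalues_pos
  have hc0 : 0 < c := by linarith
  have hd0 : 0 < ‖M.det‖ := norm_pos_iff.2 hdet
  have hle : ∀ i, hH.eigenvalues i ≤ c ^ 2 := fun i =>
    calc hH.eigenvalues i ≤ ‖H‖ := (le_abs_self _).trans (eigenvalues_le_norm hH i)
      _ = ‖M‖ * ‖M‖ := Matrix.l2_opNorm_conjTranspose_mul_self M
      _ ≤ c ^ 2 := by nlinarith [norm_nonneg M]
  have hdetH : ∏ i, hH.eigenvalues i = ‖M.det‖ ^ 2 := by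
    have h1 : H.det = ∏ i, (hH.eigenvalues i : ℂ) := hH.det_eq_prod_eigenvalues
    have h2 : ‖H.det‖ = ‖M.det‖ ^ 2 := by
      rw [hHdef, Matrix.det_mul, Matrix.det_conjTranspose, norm_mul, norm_star, sq]
    rw [← h2, h1, norm_prod]
    exact Finset.prod_congr rfl fun i _ => by
      rw [Complex.norm_real, Real.norm_of_nonneg (hpos i).le]
  have hinv : ∀ i, |(hH.eigenvalues i)⁻¹| ≤ (c ^ Fintype.card n / ‖M.det‖) ^ 2 := by
    intro i
    rw [abs_of_pos (inv_pos.2 (hpos i)), div_pow, ← hdetH, inv_eq_one_div,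
      div_le_div_iff₀ (hpos i) (Finset.prod_pos fun i _ => hpos i), one_mul,
      ← Finset.prod_erase_mul _ _ (Finset.mem_univ i)]
    refine mul_le_mul_of_nonneg_right ?_ (hpos i).le
    calc ∏ j ∈ Finset.univ.erase i, hH.eigenvalues j
        ≤ ∏ _j ∈ Finset.univ.erase i, c ^ 2 :=
          Finset.prod_le_prod (fun j _ => (hpos j).le) fun j _ => hle j
      _ = (c ^ 2) ^ (Finset.univ.erase i).card := by rw [Finset.prod_const]
      _ ≤ (c ^ 2) ^ Fintype.card n :=
          pow_le_pow_right₀ (one_le_pow₀ hc) (Finset.card_le_card (Finset.erase_subset _ _))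
      _ = (c ^ Fintype.card n) ^ 2 := by rw [← pow_mul, ← pow_mul, mul_comm]
  have hHinv := norm_inv_le_of_eigenvalues hH (sq_nonneg _) (fun i => (hpos i).ne') hinv
  have hsq : ‖M⁻¹‖ ^ 2 = ‖H⁻¹‖ := by
    rw [hHdef, Matrix.mul_inv_rev, ← Matrix.conjTranspose_nonsing_inv, sq,
      ← Matrix.l2_opNorm_conjTranspose (M⁻¹), ← Matrix.l2_opNorm_conjTranspose_mul_self,
      Matrix.conjTranspose_conjTranspose]
  rw [← hsq] at hHinv
  exact le_of_sq_le_sq hHinv (by positivity)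

/-- The determinant of `1 + τ Q` factorizes over the eigenvalues of `Q`. -/
theorem exists_det_one_add_smul_eq_prod {n : Type*} [Fintype n] [DecidableEq n]
    (Q : Matrix n n ℂ) :
    ∃ ν : Fin (Fintype.card n) → ℂ, ∀ τ : ℂ, (1 + τ • Q).det = ∏ i, (1 + τ * ν i) := by
  have hs : Q.charpoly.Splits := IsAlgClosed.splits _
  have hprod := hs.eq_prod_roots_of_monic Q.charpoly_monic
  have hcard : Q.charpoly.roots.card = Fintype.card n := by
    rw [← hs.natDegree_eq_card_roots, Q.charpoly_natDegree_eq_dim]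
  -- Listing the roots with multiplicity allows indexing by `Fin`.
  obtain ⟨l, hl⟩ := Quot.exists_rep Q.charpoly.roots
  change (l : Multiset ℂ) = _ at hl
  rw [← hl] at hprod hcard
  rw [Multiset.coe_card] at hcard
  rw [← hcard]
  refine ⟨l.get, fun τ => ?_⟩
  by_cases hτ : τ = 0
  · simp [hτ]
  -- Up to the factor `(-τ)ⁿ`, the determinant is the characteristic polynomial at `-1/τ`.
  have h1 : (1 + τ • Q) = (-τ) • (Matrix.scalar n (-τ⁻¹) - Q) := by
    rw [smul_sub, Matrix.scalar_apply, ← Matrix.smul_one_eq_diagonal, smul_smul]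
    simp [hτ]
  rw [h1, Matrix.det_smul, ← Matrix.eval_charpoly, hprod, Multiset.map_coe, Multiset.prod_coe,
    Polynomial.eval_list_prod, List.map_map, ← List.prod_ofFn, ← hcard]
  have h2 : ∀ l : List ℂ, (-τ) ^ l.length *
      (List.map ((fun p => Polynomial.eval (-τ⁻¹) p) ∘
        fun x => Polynomial.X - Polynomial.C x) l).prod =
      (l.map fun x => 1 + τ * x).prod := by
    intro l
    induction l with
    | nil => simp
    | cons a l ih =>
      rw [List.map_cons, List.prod_cons, List.map_cons, List.prod_cons, ← ih, List.length_cons,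
        pow_succ]
      simp only [Function.comp_apply, Polynomial.eval_sub, Polynomial.eval_X, Polynomial.eval_C]
      field_simp
      ring
  rw [h2]
  congr 1
  exact (List.ofFn_getElem_eq_map l _).symm

open scoped Matrix.Norms.L2Operator in
/-- A perturbation of an invertible matrix by a multiple of a diagonal matrix supported on `S`
is inverted with the help of an `S × S` determinant. -/
theorem exists_norm_inv_add_diagonal_le {m : Type*} [Fintype m] [DecidableEq m]
    (K : Matrix m m ℂ) (hK : IsUnit K) {A b : ℝ} (hb : 0 ≤ b) (hA : ‖K⁻¹‖ ≤ A)
    (v : m → ℂ) (hv : ∀ i, ‖v i‖ ≤ b) (S : Finset m) (hS : ∀ i, i ∉ S → v i = 0) :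
    ∃ ν : Fin S.card → ℂ, ∀ τ : ℂ, ‖τ‖ ≤ 2 → ∏ i, (1 + τ * ν i) ≠ 0 →
      IsUnit (K + τ • Matrix.diagonal v) ∧
      ‖(K + τ • Matrix.diagonal v)⁻¹‖ ≤
        A + 2 * b * A ^ 2 * (1 + 2 * b * A) ^ S.card / ‖∏ i, (1 + τ * ν i)‖ := by
  set R := K⁻¹ with hR
  have hKR : K * R = 1 := Matrix.mul_nonsing_inv K ((Matrix.isUnit_iff_isUnit_det K).1 hK)
  -- `V` is the isometric inclusion of the coordinates in `S`, and `V * W` factors the perturbation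
  -- through them.
  let V : Matrix m S ℂ := (1 : Matrix m m ℂ).submatrix id Subtype.val
  let w : S → ℂ := fun i => v i
  let W : Matrix S m ℂ := Matrix.diagonal w * V.conjTranspose
  have hA0 : 0 ≤ A := (norm_nonneg _).trans hA
  have hVa : ∀ i k, V i k = if i = (k : m) then 1 else 0 := fun i k => Matrix.one_apply
  have hWa : ∀ k j, W k j = v k * if j = (k : m) then 1 else 0 := by
    intro k j
    change (Matrix.diagonal w * V.conjTranspose) k j = _
    rw [Matrix.diagonal_mul, Matrix.conjTranspose_apply, hVa]
    split_ifs <;> simp [w]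
  have hVV : V.conjTranspose * V = 1 := by
    ext i j
    simp only [Matrix.mul_apply, Matrix.conjTranspose_apply, hVa, Matrix.one_apply, Subtype.ext_iff]
    rw [Finset.sum_eq_single (i : m)]
    · simp
    · intro k _ hk
      simp [hk]
    · simp
  have hV : ‖V‖ ≤ 1 := by
    have h := Matrix.l2_opNorm_conjTranspose_mul_self V
    rw [hVV] at h
    have h1 : ‖(1 : Matrix S S ℂ)‖ ≤ 1 := by
      rw [← Matrix.diagonal_one, Matrix.l2_opNorm_diagonal]
      exact (pi_norm_le_iff_of_nonneg zero_le_one).2 fun i => by simp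
    nlinarith [norm_nonneg V]
  have hW : ‖W‖ ≤ b :=
    calc ‖W‖ ≤ ‖Matrix.diagonal w‖ * ‖V.conjTranspose‖ := Matrix.l2_opNorm_mul _ _
      _ ≤ b * 1 := by
        rw [Matrix.l2_opNorm_diagonal, Matrix.l2_opNorm_conjTranspose]
        exact mul_le_mul ((pi_norm_le_iff_of_nonneg hb).2 fun i => hv i) hV (norm_nonneg _) hb
      _ = b := mul_one b
  have hVW : V * W = Matrix.diagonal v := by
    ext i j
    simp only [Matrix.mul_apply, hVa, hWa, Matrix.diagonal_apply]
    by_cases hi : i ∈ S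
    · rw [Finset.sum_eq_single ⟨i, hi⟩]
      · simp [eq_comm]
      · intro k _ hk
        have : i ≠ k := fun h => hk (Subtype.ext h.symm)
        simp [this]
      · simp
    · rw [Finset.sum_eq_zero]
      · simp [hS i hi]
      · intro k _
        have : i ≠ k := fun h => hi (h ▸ k.2)
        simp [this]
  have hQ : ‖W * R * V‖ ≤ b * A :=
    calc ‖W * R * V‖ ≤ ‖W‖ * ‖R‖ * ‖V‖ := (Matrix.l2_opNorm_mul _ _).trans
          (mul_le_mul_of_nonneg_right (Matrix.l2_opNorm_mul _ _) (norm_nonneg _))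
      _ ≤ b * A * 1 := by gcongr
      _ = b * A := mul_one _
  obtain ⟨ν, hν⟩ := exists_det_one_add_smul_eq_prod (W * R * V)
  have hcard : Fintype.card S = S.card := Fintype.card_coe S
  rw [← hcard]
  refine ⟨ν, fun τ hτ hne => ?_⟩
  rw [← hν] at hne ⊢
  set M : Matrix S S ℂ := 1 + τ • (W * R * V) with hM
  have hMnorm : ‖M‖ ≤ 1 + 2 * b * A := by
    have h1 : ‖(1 : Matrix S S ℂ)‖ ≤ 1 := by
      rw [← Matrix.diagonal_one, Matrix.l2_opNorm_diagonal]
      exact (pi_norm_le_iff_of_nonneg zero_le_one).2 fun i => by simp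
    calc ‖M‖ ≤ ‖(1 : Matrix S S ℂ)‖ + ‖τ • (W * R * V)‖ := norm_add_le _ _
      _ ≤ 1 + 2 * (b * A) := by
        rw [norm_smul]
        gcongr
      _ = 1 + 2 * b * A := by ring
  have hMinv := norm_inv_le_pow_div_det M (by nlinarith [mul_nonneg hb hA0]) hMnorm hne
  have hMM : M * M⁻¹ = 1 := Matrix.mul_nonsing_inv M (isUnit_iff_ne_zero.2 hne)
  -- Woodbury formula; the cancellation comes from inserting `M * M⁻¹ = 1` between `V` and `W`.
  have hX : (K + τ • Matrix.diagonal v) * (R - τ • (R * V * M⁻¹ * W * R)) = 1 := by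
    have e1 : K * (R * V * M⁻¹ * W * R) = V * M⁻¹ * W * R := by
      simp only [← Matrix.mul_assoc, hKR, Matrix.one_mul]
    have e2 : V * (M * M⁻¹) * W * R =
        V * M⁻¹ * W * R + τ • (V * W * (R * V * M⁻¹ * W * R)) := by
      rw [hM, Matrix.add_mul, Matrix.mul_add, Matrix.add_mul, Matrix.add_mul, ← hM]
      simp only [Matrix.one_mul, Matrix.smul_mul, Matrix.mul_smul, Matrix.mul_assoc]
    rw [hMM, Matrix.mul_one] at e2
    rw [← hVW, Matrix.add_mul, Matrix.mul_sub, Matrix.mul_sub, hKR, Matrix.mul_smul, e1,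
      Matrix.smul_mul, Matrix.smul_mul, Matrix.mul_smul, e2, smul_add]
    abel
  refine ⟨IsUnit.of_mul_eq_one _ hX, ?_⟩
  rw [Matrix.inv_eq_right_inv hX]
  calc ‖R - τ • (R * V * M⁻¹ * W * R)‖ ≤ ‖R‖ + ‖τ • (R * V * M⁻¹ * W * R)‖ := norm_sub_le _ _
    _ ≤ A + 2 * (A * 1 * ((1 + 2 * b * A) ^ Fintype.card S / ‖M.det‖) * b * A) := by
      rw [norm_smul]
      have h1 : ‖R * V * M⁻¹ * W * R‖ ≤ ‖R‖ * ‖V‖ * ‖M⁻¹‖ * ‖W‖ * ‖R‖ := by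
        refine (Matrix.l2_opNorm_mul _ _).trans ?_
        gcongr
        refine (Matrix.l2_opNorm_mul _ _).trans ?_
        gcongr
        refine (Matrix.l2_opNorm_mul _ _).trans ?_
        gcongr
        exact Matrix.l2_opNorm_mul _ _
      refine add_le_add hA (mul_le_mul hτ (h1.trans ?_) (norm_nonneg _) zero_le_two)
      gcongr
    _ = _ := by ring

/-! ### Sublevel sets of products of affine factors -/

/-- An affine factor normalized at `t₀ ∈ [-1, 1]` is bounded below on `[-1, 1]` by the distance to
a real point. -/
theorem exists_min_le_norm_one_add_mul (ν : ℂ) {t₀ : ℝ} (ht₀ : t₀ ∈ Set.Icc (-1 : ℝ) 1) :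
    ∃ x : ℝ, ∀ t ∈ Set.Icc (-1 : ℝ) 1,
      min 1 |t - x| ≤ 4 * ‖1 + ((t - t₀ : ℝ) : ℂ) * ν‖ := by
  by_cases hν : ‖ν‖ ≤ 1 / 4
  -- Since `|t - t₀| ≤ 2`, the factor has modulus at least `1/2`, and any real point would do.
  · refine ⟨0, fun t ht => (min_le_left _ _).trans ?_⟩
    have h1 : ‖((t - t₀ : ℝ) : ℂ) * ν‖ ≤ 2 * (1 / 4) := by
      rw [norm_mul, Complex.norm_real, Real.norm_eq_abs]
      refine mul_le_mul (abs_le.2 ⟨?_, ?_⟩) hν (norm_nonneg _) zero_le_two <;>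
        linarith [ht.1, ht.2, ht₀.1, ht₀.2]
    have h2 := norm_sub_le (1 + ((t - t₀ : ℝ) : ℂ) * ν) (((t - t₀ : ℝ) : ℂ) * ν)
    rw [add_sub_cancel_right, norm_one] at h2
    linarith
  · have hν' : 1 / 4 < ‖ν‖ := not_le.1 hν
    have hν0 : ν ≠ 0 := norm_pos_iff.1 (by linarith)
    -- The real part of the root of the factor, whose slope exceeds `1/4`.
    refine ⟨(t₀ - ν⁻¹).re, fun t _ => (min_le_right _ _).trans ?_⟩
    have h1 : 1 + ((t - t₀ : ℝ) : ℂ) * ν = ν * ((t : ℂ) - (t₀ - ν⁻¹)) := by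
      push_cast
      field_simp
      ring
    have h2 : |t - (t₀ - ν⁻¹).re| ≤ ‖(t : ℂ) - (t₀ - ν⁻¹)‖ := by
      have := Complex.abs_re_le_norm ((t : ℂ) - (t₀ - ν⁻¹))
      rwa [Complex.sub_re, Complex.ofReal_re] at this
    rw [h1, norm_mul]
    nlinarith [norm_nonneg ((t : ℂ) - (t₀ - ν⁻¹))]

theorem lintegral_abs_rpow_neg_half :
    ∫⁻ y in Set.Icc (-1 : ℝ) 1, ENNReal.ofReal |y| ^ (-(1 / 2) : ℝ) ≤ 4 := by
  have hpos : ∫⁻ y in Set.Ioc (0 : ℝ) 1, ENNReal.ofReal |y| ^ (-(1 / 2) : ℝ) = 2 := by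
    have h1 : ∫⁻ y in Set.Ioc (0 : ℝ) 1, ENNReal.ofReal |y| ^ (-(1 / 2) : ℝ) =
        ∫⁻ y in Set.Ioc (0 : ℝ) 1, ENNReal.ofReal (y ^ (-(1 / 2) : ℝ)) :=
      setLIntegral_congr_fun measurableSet_Ioc fun y hy => by
        rw [abs_of_pos hy.1, ENNReal.ofReal_rpow_of_pos hy.1]
    have hint : IntervalIntegrable (fun y : ℝ => y ^ (-(1 / 2) : ℝ)) volume 0 1 :=
      intervalIntegral.intervalIntegrable_rpow' (by norm_num)
    rw [h1, ← ofReal_integral_eq_lintegral_ofReal]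
    · rw [← intervalIntegral.integral_of_le zero_le_one, integral_rpow (Or.inl (by norm_num))]
      norm_num
    · exact (intervalIntegrable_iff_integrableOn_Ioc_of_le zero_le_one).1 hint
    · filter_upwards [self_mem_ae_restrict measurableSet_Ioc] with y hy
      exact Real.rpow_nonneg hy.1.le _
  have hneg : ∫⁻ y in Set.Ico (-1 : ℝ) 0, ENNReal.ofReal |y| ^ (-(1 / 2) : ℝ) = 2 := by
    rw [← hpos, ← (Measure.measurePreserving_neg (volume : Measure ℝ)).setLIntegral_comp_preimage
      measurableSet_Ioc (by fun_prop)]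
    simp
  -- At the origin the integrand is `⊤`, but a single point is null.
  have hsub : Set.Icc (-1 : ℝ) 1 ⊆ (Set.Ico (-1 : ℝ) 0 ∪ Set.Ioc (0 : ℝ) 1) ∪ {0} := by
    intro y hy
    rcases lt_trichotomy y 0 with h | h | h
    · exact Or.inl (Or.inl ⟨hy.1, h⟩)
    · exact Or.inr h
    · exact Or.inl (Or.inr ⟨h, hy.2⟩)
  calc _ ≤ ∫⁻ y in (Set.Ico (-1 : ℝ) 0 ∪ Set.Ioc (0 : ℝ) 1) ∪ {0},
        ENNReal.ofReal |y| ^ (-(1 / 2) : ℝ) := lintegral_mono_set hsub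
    _ ≤ (2 + 2) + 0 := by
      refine (lintegral_union_le _ _ _).trans (add_le_add ?_ ?_)
      · refine (lintegral_union_le _ _ _).trans (add_le_add hneg.le hpos.le)
      · simp [Measure.restrict_singleton]
    _ = 4 := by norm_num

theorem lintegral_min_abs_sub_rpow_neg_half (x : ℝ) :
    ∫⁻ t in Set.Icc (-1 : ℝ) 1, ENNReal.ofReal (min 1 |t - x|) ^ (-(1 / 2) : ℝ) ≤ 6 := by
  have hle : ∀ t : ℝ, ENNReal.ofReal (min 1 |t - x|) ^ (-(1 / 2) : ℝ) ≤
      1 + (Set.Icc (-1 : ℝ) 1).indicator (fun y => ENNReal.ofReal |y| ^ (-(1 / 2) : ℝ)) (t - x) := by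
    intro t
    by_cases h : |t - x| ≤ 1
    · rw [Set.indicator_of_mem (Set.mem_Icc.2 (abs_le.1 h)), min_eq_right h]
      exact le_add_self
    · rw [min_eq_left (not_le.1 h).le]
      simp
  calc _ ≤ ∫⁻ t in Set.Icc (-1 : ℝ) 1, (1 + (Set.Icc (-1 : ℝ) 1).indicator
        (fun y => ENNReal.ofReal |y| ^ (-(1 / 2) : ℝ)) (t - x)) := lintegral_mono fun t => hle t
    _ = (∫⁻ _t in Set.Icc (-1 : ℝ) 1, 1) + ∫⁻ t in Set.Icc (-1 : ℝ) 1,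
        (Set.Icc (-1 : ℝ) 1).indicator (fun y => ENNReal.ofReal |y| ^ (-(1 / 2) : ℝ)) (t - x) :=
      lintegral_add_left measurable_const _
    _ ≤ 2 + 4 := by
      refine add_le_add ?_ ?_
      · simp only [lintegral_const, one_mul, Measure.restrict_apply_univ, Real.volume_Icc]
        norm_num
      · refine (setLIntegral_le_lintegral _ _).trans ?_
        rw [lintegral_sub_right_eq_self (μ := (volume : Measure ℝ)) (fun y =>
          (Set.Icc (-1 : ℝ) 1).indicator (fun y => ENNReal.ofReal |y| ^ (-(1 / 2) : ℝ)) y) x,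
          lintegral_indicator measurableSet_Icc]
        exact lintegral_abs_rpow_neg_half
    _ = 6 := by norm_num

/-- A sublevel set estimate for products of `N` truncated distances. -/
theorem volume_prod_min_abs_sub_le {N : ℕ} (hN : 0 < N) (x : Fin N → ℝ) {η : ℝ} (hη : 0 < η) :
    volume {t ∈ Set.Icc (-1 : ℝ) 1 | ∏ i, min 1 |t - x i| ≤ η} ≤
      6 * ENNReal.ofReal (η ^ (1 / (2 * N) : ℝ)) := by
  have hN' : (0 : ℝ) < N := by exact_mod_cast hN
  set ν := (volume : Measure ℝ).restrict (Set.Icc (-1 : ℝ) 1)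
  set f : Fin N → ℝ → ENNReal := fun i t => ENNReal.ofReal (min 1 |t - x i|) ^ (-(1 / 2) : ℝ)
  have hfm : ∀ i, Measurable (f i) := fun i => by fun_prop
  -- Hölder with `N` equal weights keeps the bound independent of `N`.
  have hint : ∫⁻ t, ∏ i, f i t ^ (1 / N : ℝ) ∂ν ≤ 6 := by
    refine (ENNReal.lintegral_prod_norm_pow_le (μ := ν) Finset.univ
      (fun i _ => (hfm i).aemeasurable) (p := fun _ => (1 / N : ℝ)) ?_ ?_).trans ?_
    · simp [hN'.ne']
    · intro i _; positivity
    · calc ∏ i, (∫⁻ t, f i t ∂ν) ^ (1 / N : ℝ) ≤ ∏ _i : Fin N, (6 : ENNReal) ^ (1 / N : ℝ) :=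
            Finset.prod_le_prod' fun i _ => ENNReal.rpow_le_rpow
              (lintegral_min_abs_sub_rpow_neg_half (x i)) (by positivity)
        _ = 6 := by
          rw [Finset.prod_const, Finset.card_univ, Fintype.card_fin, ← ENNReal.rpow_natCast,
            ← ENNReal.rpow_mul, one_div_mul_cancel hN'.ne', ENNReal.rpow_one]
  -- The Markov threshold: the integrand is the product of distances to the power `-1/(2N)`.
  set ε : ENNReal := ENNReal.ofReal η ^ (-(1 / (2 * N)) : ℝ) with hε
  have hεη : ENNReal.ofReal (η ^ (1 / (2 * N) : ℝ)) * ε = 1 := by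
    rw [hε, ENNReal.ofReal_rpow_of_pos hη, ← ENNReal.ofReal_mul (by positivity),
      ← Real.rpow_add hη, add_neg_cancel, Real.rpow_zero, ENNReal.ofReal_one]
  have hsub : {t | ∏ i, min 1 |t - x i| ≤ η} ⊆ {t | ε ≤ ∏ i, f i t ^ (1 / N : ℝ)} := by
    intro t ht
    have h1 : ∏ i, f i t ^ (1 / N : ℝ) =
        ENNReal.ofReal (∏ i, min 1 |t - x i|) ^ (-(1 / (2 * N)) : ℝ) := by
      rw [ENNReal.ofReal_prod_of_nonneg fun i _ => le_min zero_le_one (abs_nonneg _),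
        ← ENNReal.prod_rpow_of_ne_top fun i _ => ENNReal.ofReal_ne_top]
      refine Finset.prod_congr rfl fun i _ => ?_
      rw [← ENNReal.rpow_mul]
      congr 1
      field_simp
    rw [Set.mem_ofPred_eq, h1, hε, ENNReal.rpow_neg, ENNReal.rpow_neg]
    exact ENNReal.inv_le_inv.2 (ENNReal.rpow_le_rpow (ENNReal.ofReal_le_ofReal ht) (by positivity))
  have hmarkov := mul_meas_ge_le_lintegral₀ (μ := ν) (f := fun t => ∏ i, f i t ^ (1 / N : ℝ))
    (by fun_prop) ε
  calc volume {t ∈ Set.Icc (-1 : ℝ) 1 | ∏ i, min 1 |t - x i| ≤ η}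
      = ν {t | ∏ i, min 1 |t - x i| ≤ η} := by
        rw [Measure.restrict_apply' measurableSet_Icc, Set.inter_comm]
        rfl
    _ ≤ ν {t | ε ≤ ∏ i, f i t ^ (1 / N : ℝ)} := measure_mono hsub
    _ = ENNReal.ofReal (η ^ (1 / (2 * N) : ℝ)) *
        (ε * ν {t | ε ≤ ∏ i, f i t ^ (1 / N : ℝ)}) := by rw [← mul_assoc, hεη, one_mul]
    _ ≤ ENNReal.ofReal (η ^ (1 / (2 * N) : ℝ)) * 6 := by
      gcongr
      exact hmarkov.trans hint
    _ = _ := mul_comm _ _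

/-! ### Resampling, dependence on one coordinate, measurability -/

/-- Resampling one coordinate of an i.i.d. family does not change its law. -/
theorem map_update_iidLaw {d : ℕ} (μ : Measure ℝ) [IsProbabilityMeasure μ] (n : Fin d → ℤ) :
    ((iidLaw d μ).prod μ).map (fun p => Function.update p.1 n p.2) = iidLaw d μ := by
  have hm : Measurable fun p : ((Fin d → ℤ) → ℝ) × ℝ => Function.update p.1 n p.2 :=
    measurable_update'
  refine Measure.eq_infinitePi _ fun s t ht => ?_
  rw [Measure.map_apply hm (MeasurableSet.pi s.countable_toSet fun i _ => ht i)]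
  have hpre : (fun p : ((Fin d → ℤ) → ℝ) × ℝ => Function.update p.1 n p.2) ⁻¹'
      ((s : Set (Fin d → ℤ)).pi t) =
      (((s.erase n : Finset _) : Set (Fin d → ℤ)).pi t) ×ˢ (if n ∈ s then t n else Set.univ) := by
    ext ⟨ω, a⟩
    simp only [Set.mem_preimage, Set.mem_pi, Finset.mem_coe, Set.mem_prod, Finset.mem_erase]
    constructor
    · intro h
      refine ⟨fun i hi => ?_, ?_⟩
      · simpa [hi.1] using h i hi.2
      · split_ifs with hn
        · simpa using h n hn
        · trivial
    · rintro ⟨h1, h2⟩ i hi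
      by_cases hin : i = n
      · subst hin
        simpa [hi] using h2
      · simpa [hin] using h1 i ⟨hin, hi⟩
  rw [hpre, Measure.prod_prod, iidLaw, Measure.infinitePi_pi _ fun i _ => ht i]
  split_ifs with hn
  · rw [Finset.prod_erase_mul _ _ hn]
  · rw [measure_univ, mul_one, Finset.erase_eq_of_notMem hn]

theorem potential_eq_sum {d : ℕ} {u : (Fin d → ℤ) → ℝ} {F : Finset (Fin d → ℤ)}
    (hF : Function.support u ⊆ F) (ω : (Fin d → ℤ) → ℝ) (x : Fin d → ℤ) :
    potential u ω x = ∑ k ∈ F, ω (x - k) * u k := by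
  have h1 : potential u ω x = ∑' k, ω (x - k) * u k := by
    rw [potential, ← (Equiv.subLeft x).tsum_eq]
    simp
  rw [h1, tsum_eq_sum]
  intro k hk
  have : u k = 0 := by
    by_contra h
    exact hk (hF h)
  rw [this, mul_zero]

theorem continuous_boxHamiltonian {d : ℕ} (lam : ℝ) {u : (Fin d → ℤ) → ℝ}
    {F : Finset (Fin d → ℤ)} (hF : Function.support u ⊆ F) (Γ : Finset (Fin d → ℤ)) :
    Continuous fun ω => boxHamiltonian lam u ω Γ := by
  refine continuous_matrix fun x y => ?_
  simp only [boxHamiltonian, Matrix.of_apply, hamiltonian, potential_eq_sum hF]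
  fun_prop

theorem potential_update {d : ℕ} {u : (Fin d → ℤ) → ℝ} {F : Finset (Fin d → ℤ)}
    (hF : Function.support u ⊆ F) (ω : (Fin d → ℤ) → ℝ) (n : Fin d → ℤ) (t t₀ : ℝ)
    (x : Fin d → ℤ) :
    potential u (Function.update ω n t) x =
      potential u (Function.update ω n t₀) x + (t - t₀) * u (x - n) := by
  rw [potential_eq_sum hF, potential_eq_sum hF, ← sub_eq_iff_eq_add', ← Finset.sum_sub_distrib,
    Finset.sum_eq_single (x - n)]
  · simp [sub_mul]
  · intro k _ hk
    have : x - k ≠ n := fun h => hk (by rw [← h, sub_sub_cancel])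
    simp [this]
  · intro h
    have : u (x - n) = 0 := by
      by_contra h'
      exact h (hF h')
    simp [this]

theorem boxHamiltonian_update {d : ℕ} (lam : ℝ) {u : (Fin d → ℤ) → ℝ} {F : Finset (Fin d → ℤ)}
    (hF : Function.support u ⊆ F) (ω : (Fin d → ℤ) → ℝ) (n : Fin d → ℤ) (t t₀ : ℝ)
    (Γ : Finset (Fin d → ℤ)) :
    boxHamiltonian lam u (Function.update ω n t) Γ =
      boxHamiltonian lam u (Function.update ω n t₀) Γ +
        ((t - t₀ : ℝ) : ℂ) • Matrix.diagonal fun x : Γ => ((lam * u (x - n) : ℝ) : ℂ) := by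
  ext x y
  simp only [boxHamiltonian, Matrix.of_apply, Matrix.add_apply, Matrix.smul_apply, hamiltonian,
    potential_update hF ω n t t₀, Matrix.diagonal_apply, smul_eq_mul]
  by_cases h : x = y
  · subst h
    simp
    ring
  · have : (x : Fin d → ℤ) ≠ y := fun h' => h (Subtype.ext h')
    simp [h, this]

-- Clearing the determinant gives a closed condition on `ω`, which yields measurability. It also
-- covers the singular case, where the left side is zero.
open scoped Matrix.Norms.L2Operator in
theorem le_resolventNorm_iff {d : ℕ} (lam : ℝ) (u ω : (Fin d → ℤ) → ℝ) (Γ : Finset (Fin d → ℤ))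
    (E c : ℝ) :
    ENNReal.ofReal c ≤ resolventNorm lam u ω Γ E ↔
      c * ‖(boxHamiltonian lam u ω Γ - (E : ℂ) • (1 : Matrix Γ Γ ℂ)).det‖ ≤
        ‖(boxHamiltonian lam u ω Γ - (E : ℂ) • (1 : Matrix Γ Γ ℂ)).adjugate‖ := by
  rw [resolventNorm]
  set X := boxHamiltonian lam u ω Γ - (E : ℂ) • (1 : Matrix Γ Γ ℂ)
  split_ifs with h
  · have hdet := (Matrix.isUnit_iff_isUnit_det X).1 h
    have hpos : 0 < ‖X.det‖ := norm_pos_iff.2 hdet.ne_zero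
    rw [← Matrix.cstar_norm_def, ENNReal.ofReal_le_ofReal_iff (norm_nonneg _), Matrix.inv_def,
      Ring.inverse_eq_inv', norm_smul, norm_inv, inv_mul_eq_div, le_div_iff₀ hpos]
  · have hdet : X.det = 0 := by
      by_contra h'
      exact h ((Matrix.isUnit_iff_isUnit_det X).2 (isUnit_iff_ne_zero.2 h'))
    simp [hdet]

open scoped Matrix.Norms.L2Operator in
theorem measurableSet_le_resolventNorm {d : ℕ} (lam : ℝ) {u : (Fin d → ℤ) → ℝ}
    {F : Finset (Fin d → ℤ)} (hF : Function.support u ⊆ F) (Γ : Finset (Fin d → ℤ))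
    (E c : ℝ) :
    MeasurableSet {ω | ENNReal.ofReal c ≤ resolventNorm lam u ω Γ E} := by
  simp only [le_resolventNorm_iff]
  have hX : Continuous fun ω => boxHamiltonian lam u ω Γ - (E : ℂ) • (1 : Matrix Γ Γ ℂ) :=
    (continuous_boxHamiltonian lam hF Γ).sub continuous_const
  exact (isClosed_le (continuous_const.mul hX.matrix_det.norm) hX.matrix_adjugate.norm).measurableSet

/-- Fubini for the resampled family: a bound on almost every one-coordinate fibre passes to the
whole space. -/
theorem iidLaw_le_of_resample {d : ℕ} (μ : Measure ℝ) [IsProbabilityMeasure μ] (n : Fin d → ℤ)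
    {S : Set ((Fin d → ℤ) → ℝ)} (hS : MeasurableSet S) {c : ENNReal}
    (h : ∀ᵐ ω ∂(iidLaw d μ), μ {t | Function.update ω n t ∈ S} ≤ c) : iidLaw d μ S ≤ c := by
  have : IsProbabilityMeasure (iidLaw d μ) := by unfold iidLaw; infer_instance
  have hm : Measurable fun p : ((Fin d → ℤ) → ℝ) × ℝ => Function.update p.1 n p.2 :=
    measurable_update'
  rw [← map_update_iidLaw μ n, Measure.map_apply hm hS, Measure.prod_apply (hm hS)]
  calc _ ≤ ∫⁻ _ω, c ∂(iidLaw d μ) := lintegral_mono_ae h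
    _ = c := by simp

theorem withDensity_le_restrict {ρ : ℝ → ℝ} {K : ℝ} (hK : ∀ x, ρ x ≤ K)
    (hρs : Function.support ρ ⊆ Set.Icc (-1 : ℝ) 1) (T : Set ℝ) :
    (volume.withDensity fun x => ENNReal.ofReal (ρ x)) T ≤
      ENNReal.ofReal K * volume (Set.Icc (-1 : ℝ) 1 ∩ T) := by
  rw [withDensity_apply']
  have hle : ∀ x, ENNReal.ofReal (ρ x) ≤
      (Set.Icc (-1 : ℝ) 1).indicator (fun _ => ENNReal.ofReal K) x := by
    intro x
    by_cases hx : x ∈ Set.Icc (-1 : ℝ) 1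
    · rw [Set.indicator_of_mem hx]
      exact ENNReal.ofReal_le_ofReal (hK x)
    · have : ρ x = 0 := by
        by_contra h
        exact hx (hρs h)
      simp [this]
  calc _ ≤ ∫⁻ x in T, (Set.Icc (-1 : ℝ) 1).indicator (fun _ => ENNReal.ofReal K) x :=
        lintegral_mono hle
    _ = _ := by
      rw [lintegral_indicator measurableSet_Icc, lintegral_const, Measure.restrict_apply_univ,
        Measure.restrict_apply measurableSet_Icc]

/-! ### The estimate on a fibre -/

/-- The measure of the large resolvents on the fibre over all coordinates but one. -/
theorem measure_fibre_le {d : ℕ} {lam B K A r : ℝ} (hlam : 0 < lam) (hB : 0 ≤ B) (hA : 1 ≤ A)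
    {u : (Fin d → ℤ) → ℝ} (hu : ∀ x, |u x| ≤ B) (hr : 0 ≤ r)
    (hsupp : Function.support u ⊆ (cube r (0 : Fin d → ℤ) : Set (Fin d → ℤ)))
    {ρ : ℝ → ℝ} (hK : ∀ x, ρ x ≤ K) (hρs : Function.support ρ ⊆ Set.Icc (-1 : ℝ) 1)
    (Γ : Finset (Fin d → ℤ)) (h0 : 0 ∈ Γ) (E s : ℝ) (hs : 2 * A ≤ Real.exp s)
    (ω : (Fin d → ℤ) → ℝ) {t₀ : ℝ} (ht₀ : t₀ ∈ Set.Icc (-1 : ℝ) 1)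
    (hω : resolventNorm lam u (Function.update ω 0 t₀) Γ E ≤ ENNReal.ofReal A) :
    (volume.withDensity fun x => ENNReal.ofReal (ρ x))
      {t | ENNReal.ofReal (Real.exp s) ≤ resolventNorm lam u (Function.update ω 0 t) Γ E} ≤
      ENNReal.ofReal K * (6 * ENNReal.ofReal
        ((8 * (1 + 2 * (lam * B)) * A) ^ (3 / 2 : ℝ) *
          Real.exp (-(s / (2 * (cube r (0 : Fin d → ℤ)).card))))) := by
  classical
  have hA0 : 0 < A := by linarith
  set b := lam * B with hbdef
  have hb : 0 ≤ b := mul_nonneg hlam.le hB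
  set K₀ := boxHamiltonian lam u (Function.update ω 0 t₀) Γ - (E : ℂ) • (1 : Matrix Γ Γ ℂ)
    with hK₀
  have hunit : IsUnit K₀ := by
    by_contra h
    rw [resolventNorm, if_neg h] at hω
    exact ENNReal.ofReal_ne_top (top_le_iff.1 hω)
  rw [resolventNorm, if_pos hunit, ENNReal.ofReal_le_ofReal_iff hA0.le,
    ← Matrix.cstar_norm_def] at hω
  set v : Γ → ℂ := fun x => ((lam * u (x - 0) : ℝ) : ℂ) with hv
  set S : Finset Γ := Finset.univ.filter fun x => (x : Fin d → ℤ) ∈ cube r (0 : Fin d → ℤ)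
  have h0r : (0 : Fin d → ℤ) ∈ cube r (0 : Fin d → ℤ) := (mem_cube r 0 0).2 fun i => by simpa
  have hSpos : 0 < S.card := Finset.card_pos.2 ⟨⟨0, h0⟩, by simpa [S] using h0r⟩
  have hSle : S.card ≤ (cube r (0 : Fin d → ℤ)).card :=
    Finset.card_le_card_of_injOn Subtype.val (fun x hx => by simpa [S] using hx)
      Subtype.val_injective.injOn
  obtain ⟨ν, hν⟩ := exists_norm_inv_add_diagonal_le K₀ hunit hb hω v
    (fun x => by
      rw [hv, Complex.norm_real, Real.norm_eq_abs, abs_mul, abs_of_pos hlam]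
      exact mul_le_mul_of_nonneg_left (hu _) hlam.le) S
    (fun x hx => by
      have : u (x - 0) = 0 := by
        by_contra h
        exact hx (by simpa [S] using hsupp h)
      change ((lam * u (x - 0) : ℝ) : ℂ) = 0
      rw [this, mul_zero, Complex.ofReal_zero])
  choose x hx using fun i => exists_min_le_norm_one_add_mul (ν i) ht₀
  set g := 8 * (1 + 2 * b) * A with hg
  have hg1 : 1 ≤ g := by nlinarith
  have hg0 : 0 < g := by linarith
  -- The power absorbs `4^|S|` from the affine factors and every power of `A` from the Woodbury
  -- bound; after the root of order `2|S|` only `g^(3/2)` remains.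
  set η := g ^ (3 * S.card) * Real.exp (-s) with hη
  have hη0 : 0 < η := by positivity
  have hsub : Set.Icc (-1 : ℝ) 1 ∩
      {t | ENNReal.ofReal (Real.exp s) ≤ resolventNorm lam u (Function.update ω 0 t) Γ E} ⊆
      {t ∈ Set.Icc (-1 : ℝ) 1 | ∏ i, min 1 |t - x i| ≤ η} := by
    rintro t ⟨ht, hbig⟩
    refine ⟨ht, ?_⟩
    set D := ∏ i, (1 + ((t - t₀ : ℝ) : ℂ) * ν i) with hD
    have hprod : ∏ i, min 1 |t - x i| ≤ 4 ^ S.card * ‖D‖ :=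
      calc ∏ i, min 1 |t - x i| ≤ ∏ i, (4 * ‖1 + ((t - t₀ : ℝ) : ℂ) * ν i‖) :=
            Finset.prod_le_prod (fun i _ => le_min zero_le_one (abs_nonneg _))
              fun i _ => hx i t ht
        _ = 4 ^ S.card * ‖D‖ := by
          rw [Finset.prod_mul_distrib, Finset.prod_const, Finset.card_univ, Fintype.card_fin,
            hD, norm_prod]
    by_cases hD0 : D = 0
    · rw [hD0, norm_zero, mul_zero] at hprod
      exact hprod.trans hη0.le
    have hDpos : 0 < ‖D‖ := norm_pos_iff.2 hD0
    have hτ : ‖((t - t₀ : ℝ) : ℂ)‖ ≤ 2 := by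
      rw [Complex.norm_real, Real.norm_eq_abs]
      exact abs_le.2 ⟨by linarith [ht.1, ht₀.2], by linarith [ht.2, ht₀.1]⟩
    obtain ⟨hun, hno⟩ := hν _ hτ hD0
    have hupd : boxHamiltonian lam u (Function.update ω 0 t) Γ - (E : ℂ) • (1 : Matrix Γ Γ ℂ) =
        K₀ + ((t - t₀ : ℝ) : ℂ) • Matrix.diagonal v := by
      rw [boxHamiltonian_update lam hsupp ω 0 t t₀, hK₀]
      abel
    change ENNReal.ofReal (Real.exp s) ≤ _ at hbig
    rw [resolventNorm, hupd, if_pos hun, ENNReal.ofReal_le_ofReal_iff (norm_nonneg _),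
      ← Matrix.cstar_norm_def] at hbig
    -- The additive term `A` is at most half of `exp s`.
    have h1 : Real.exp s ≤ 2 * (2 * b * A ^ 2 * (1 + 2 * b * A) ^ S.card / ‖D‖) := by
      linarith [hbig.trans hno]
    have h2 : ‖D‖ ≤ 2 * (2 * b * A ^ 2 * (1 + 2 * b * A) ^ S.card) * Real.exp (-s) := by
      rw [Real.exp_neg, ← div_eq_mul_inv, le_div_iff₀ (Real.exp_pos s)]
      rw [mul_div_assoc', le_div_iff₀ hDpos] at h1
      linarith
    have hG : 1 ≤ (1 + 2 * b) * A := by nlinarith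
    have h3 : 2 * b * A ^ 2 ≤ ((1 + 2 * b) * A) ^ 2 := by
      rw [mul_pow]
      exact mul_le_mul_of_nonneg_right (by nlinarith) (sq_nonneg A)
    have h4 : 1 + 2 * b * A ≤ (1 + 2 * b) * A := by nlinarith
    calc ∏ i, min 1 |t - x i| ≤ 4 ^ S.card *
          (2 * (2 * b * A ^ 2 * (1 + 2 * b * A) ^ S.card) * Real.exp (-s)) :=
          hprod.trans (mul_le_mul_of_nonneg_left h2 (by positivity))
      _ ≤ 4 ^ S.card * (2 ^ S.card * (((1 + 2 * b) * A) ^ 2 * ((1 + 2 * b) * A) ^ S.card) *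
          Real.exp (-s)) := by
          have : (2 : ℝ) ≤ 2 ^ S.card := le_self_pow₀ one_le_two hSpos.ne'
          gcongr
      _ = 8 ^ S.card * ((1 + 2 * b) * A) ^ (2 + S.card) * Real.exp (-s) := by
          rw [pow_add, show (8 : ℝ) ^ S.card = 4 ^ S.card * 2 ^ S.card by
            rw [← mul_pow]; norm_num]
          ring
      -- `2 + |S| ≤ 3|S|`, as the site `0` lies in `S`.
      _ ≤ 8 ^ (3 * S.card) * ((1 + 2 * b) * A) ^ (3 * S.card) * Real.exp (-s) := by
          gcongr
          · norm_num
          · omega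
          · omega
      _ = η := by rw [hη, hg, ← mul_pow, mul_assoc 8]
  refine (withDensity_le_restrict hK hρs _).trans (mul_le_mul_right ?_ _)
  refine (measure_mono hsub).trans ((volume_prod_min_abs_sub_le hSpos x hη0).trans ?_)
  have hS0 : (0 : ℝ) < S.card := by exact_mod_cast hSpos
  have hs0 : 0 ≤ s := by
    rw [← Real.one_le_exp_iff]
    linarith
  gcongr
  rw [hη, Real.mul_rpow (by positivity) (Real.exp_pos _).le, ← Real.rpow_natCast, ← Real.rpow_mul
    hg0.le, ← Real.exp_mul]
  have e1 : ((3 * S.card : ℕ) : ℝ) * (1 / (2 * S.card)) = 3 / 2 := by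
    push_cast
    field_simp
  rw [e1]
  refine mul_le_mul_of_nonneg_left (Real.exp_le_exp.2 ?_) (by positivity)
  rw [neg_mul, mul_one_div, neg_le_neg_iff]
  gcongr

theorem card_cube_le {d : ℕ} {r : ℝ} (hr : 1 ≤ r) (x : Fin d → ℤ) :
    ((cube r x).card : ℝ) ≤ 3 ^ d * r ^ d := by
  have h0 : (0 : ℤ) ≤ ⌊r⌋ := Int.floor_nonneg.2 (by linarith)
  have h1 : ∀ i : Fin d, (Finset.Icc (x i - ⌊r⌋) (x i + ⌊r⌋)).card = (2 * ⌊r⌋ + 1).toNat := by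
    intro i
    rw [Int.card_Icc]
    congr 1
    ring
  have h2 : (((2 * ⌊r⌋ + 1).toNat : ℕ) : ℝ) ≤ 3 * r := by
    have h3 : (((2 * ⌊r⌋ + 1).toNat : ℕ) : ℤ) = 2 * ⌊r⌋ + 1 := Int.toNat_of_nonneg (by omega)
    have h4 : (((2 * ⌊r⌋ + 1).toNat : ℕ) : ℝ) = 2 * ⌊r⌋ + 1 := by exact_mod_cast h3
    rw [h4]
    linarith [Int.floor_le r]
  rw [cube, Pi.card_Icc, Finset.prod_congr rfl fun i _ => h1 i, Finset.prod_const,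
    Finset.card_univ, Fintype.card_fin, ← mul_pow]
  push_cast
  exact pow_le_pow_left₀ (Nat.cast_nonneg _) h2 d

/-! ### Constants uniform in `A` and `r` -/

/-- Interpolation with the trivial bound `p ≤ 1` replaces a prefactor polynomial in `exp a`
by a constant, at the price of a rate proportional to `1 / a`. -/
theorem le_exp_of_le_one_of_le {p M q a a₀ Y : ℝ} (hp0 : 0 ≤ p) (hp1 : p ≤ 1) (hM : 1 ≤ M)
    (hq : 0 ≤ q) (ha₀ : 0 < a₀) (ha : a₀ ≤ a) (hp : p ≤ M * Real.exp (q * a) * Real.exp (-Y)) :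
    p ≤ M * Real.exp q * Real.exp (-(min 1 a₀ * Y / a)) := by
  have hapos : 0 < a := by linarith
  set c := min 1 a₀ with hc
  have hc0 : 0 < c := lt_min one_pos ha₀
  have hc1 : c ≤ 1 := min_le_left _ _
  have hθ0 : 0 ≤ c / a := by positivity
  have hθ1 : c / a ≤ 1 := (div_le_one hapos).2 ((min_le_right _ _).trans ha)
  calc p ≤ p ^ (c / a) := by
        rcases hp0.eq_or_lt with h | h
        · rw [← h]; exact Real.rpow_nonneg le_rfl _
        · simpa using Real.rpow_le_rpow_of_exponent_ge h hp1 hθ1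
    _ ≤ (M * Real.exp (q * a) * Real.exp (-Y)) ^ (c / a) := Real.rpow_le_rpow hp0 hp hθ0
    _ = M ^ (c / a) * Real.exp (q * c) * Real.exp (-(c * Y / a)) := by
        rw [Real.mul_rpow (by positivity) (Real.exp_pos _).le,
          Real.mul_rpow (by linarith) (Real.exp_pos _).le, ← Real.exp_mul, ← Real.exp_mul]
        congr 3
        · field_simp
        · field_simp
    _ ≤ M * Real.exp q * Real.exp (-(c * Y / a)) := by
        gcongr
        · simpa using Real.rpow_le_rpow_of_exponent_le hM hθ1
        · nlinarith

/-- The Wegner type estimate from a modification at the single site `0`. -/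
theorem iidLaw_le_resolventNorm_le {d : ℕ} {lam B K : ℝ} (hlam : 0 < lam) (hB : 0 ≤ B)
    {u : (Fin d → ℤ) → ℝ} (hu : ∀ x, |u x| ≤ B)
    (μ : Measure ℝ) [IsProbabilityMeasure μ] {ρ : ℝ → ℝ} (hK : ∀ x, ρ x ≤ K)
    (hρs : Function.support ρ ⊆ Set.Icc (-1 : ℝ) 1)
    (hμ : μ = volume.withDensity fun x => ENNReal.ofReal (ρ x))
    {E L r A s : ℝ} (hL : 0 < L) (hr : 1 ≤ r) (hA : 1 ≤ A)
    (hmod : ModificationBound lam u μ E L A)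
    (hsupp : Function.support u ⊆ (cube r (0 : Fin d → ℤ) : Set (Fin d → ℤ)))
    (hs : 2 * A ≤ Real.exp s) :
    (iidLaw d μ {ω | ENNReal.ofReal (Real.exp s) ≤
      resolventNorm lam u ω (cube L 0) E}).toReal ≤
      (1 + 6 * |K| * (8 * (1 + 2 * (lam * B))) ^ (3 / 2 : ℝ)) *
        Real.exp (3 / 2 * Real.log A) * Real.exp (-(s / (2 * 3 ^ d) / r ^ d)) := by
  have hA0 : 0 < A := by linarith
  have h0 : (0 : Fin d → ℤ) ∈ cube L (0 : Fin d → ℤ) :=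
    (mem_cube L 0 0).2 fun i => by simpa using hL.le
  have h0r : (0 : Fin d → ℤ) ∈ cube r (0 : Fin d → ℤ) :=
    (mem_cube r 0 0).2 fun i => by simpa using (by linarith : (0 : ℝ) ≤ r)
  set N : ℝ := ((cube r (0 : Fin d → ℤ)).card : ℝ) with hN
  have hN0 : 0 < N := by
    rw [hN]
    exact_mod_cast Finset.card_pos.2 ⟨_, h0r⟩
  have hs0 : 0 ≤ s := by
    rw [← Real.one_le_exp_iff]
    linarith
  have hG : 0 ≤ 8 * (1 + 2 * (lam * B)) := by positivity
  have hmain := iidLaw_le_of_resample μ 0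
    (measurableSet_le_resolventNorm lam hsupp (cube L 0) E (Real.exp s))
    (c := ENNReal.ofReal K * (6 * ENNReal.ofReal
        ((8 * (1 + 2 * (lam * B)) * A) ^ (3 / 2 : ℝ) * Real.exp (-(s / (2 * N)))))) (by
      filter_upwards [hmod] with ω hω
      obtain ⟨ω', h1, h2, h3⟩ := hω 0 h0
      have hω' : ω' = Function.update ω 0 (ω' 0) := by
        ext m
        by_cases hm : m = 0
        · subst hm; simp
        · simp [hm, h1 m hm]
      rw [hω'] at h3
      rw [hμ]
      exact measure_fibre_le hlam hB hA hu (by linarith) hsupp hK hρs (cube L 0) h0 E s hs ω h2 h3)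
  refine (ENNReal.toReal_mono ?_ hmain).trans ?_
  · exact ENNReal.mul_ne_top ENNReal.ofReal_ne_top
      (ENNReal.mul_ne_top (by norm_num) ENNReal.ofReal_ne_top)
  rw [ENNReal.toReal_mul, ENNReal.toReal_mul, Real.mul_rpow hG hA0.le,
    ENNReal.toReal_ofReal (mul_nonneg (mul_nonneg (Real.rpow_nonneg hG _)
      (Real.rpow_nonneg hA0.le _)) (Real.exp_pos _).le)]
  have hKK : (ENNReal.ofReal K).toReal ≤ |K| := by
    rw [ENNReal.toReal_ofReal']
    exact max_le (le_abs_self K) (abs_nonneg K)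
  have hAexp : A ^ (3 / 2 : ℝ) = Real.exp (3 / 2 * Real.log A) := by
    rw [Real.rpow_def_of_pos hA0, mul_comm]
  have h6 : (6 : ENNReal).toReal = 6 := by norm_num
  have hexp : Real.exp (-(s / (2 * N))) ≤ Real.exp (-(s / (2 * 3 ^ d) / r ^ d)) := by
    rw [Real.exp_le_exp, neg_le_neg_iff, div_div]
    refine div_le_div_of_nonneg_left hs0 (by positivity) ?_
    rw [mul_assoc]
    exact mul_le_mul_of_nonneg_left (card_cube_le hr 0) zero_le_two
  rw [hAexp, h6]
  calc _ ≤ |K| * (6 * ((8 * (1 + 2 * (lam * B))) ^ (3 / 2 : ℝ) * Real.exp (3 / 2 * Real.log A) *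
        Real.exp (-(s / (2 * 3 ^ d) / r ^ d)))) := by gcongr
    _ = (6 * |K| * (8 * (1 + 2 * (lam * B))) ^ (3 / 2 : ℝ)) *
        Real.exp (3 / 2 * Real.log A) * Real.exp (-(s / (2 * 3 ^ d) / r ^ d)) := by ring
    _ ≤ _ := by
      gcongr
      linarith

/-- A uniform version of the estimate, with a constant independent of `A` and `r`. -/
theorem exists_iidLaw_le_resolventNorm_le (d : ℕ) {lam B K A₀ : ℝ} (hlam : 0 < lam) (hB : 0 ≤ B)
    {u : (Fin d → ℤ) → ℝ} (hu : ∀ x, |u x| ≤ B)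
    (μ : Measure ℝ) [IsProbabilityMeasure μ] {ρ : ℝ → ℝ} (hK : ∀ x, ρ x ≤ K)
    (hρs : Function.support ρ ⊆ Set.Icc (-1 : ℝ) 1)
    (hμ : μ = volume.withDensity fun x => ENNReal.ofReal (ρ x)) (hA₀ : 1 < A₀) :
    ∃ δ : ℝ, 0 < δ ∧ ∃ C : ℝ, 1 ≤ C ∧ ∀ E L r A : ℝ, 0 < L → 1 ≤ r → A₀ ≤ A →
      ModificationBound lam u μ E L A →
      Function.support u ⊆ (cube r (0 : Fin d → ℤ) : Set (Fin d → ℤ)) → ∀ s : ℝ, 0 ≤ s →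
        iidLaw d μ {ω | ENNReal.ofReal (Real.exp s) ≤ resolventNorm lam u ω (cube L 0) E} ≤
          ENNReal.ofReal (C * Real.exp (-(δ * s / (Real.log A * r ^ d)))) := by
  have hprob : IsProbabilityMeasure (iidLaw d μ) := by unfold iidLaw; infer_instance
  set a₀ := Real.log A₀ with ha₀
  have ha₀pos : 0 < a₀ := Real.log_pos hA₀
  set c := min 1 a₀ with hc
  have hc0 : 0 < c := lt_min one_pos ha₀pos
  set δ := c / (2 * 3 ^ d) with hδ
  have hδ0 : 0 < δ := by positivity
  set M := 1 + 6 * |K| * (8 * (1 + 2 * (lam * B))) ^ (3 / 2 : ℝ) with hMdef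
  have hM : 1 ≤ M := le_add_of_nonneg_right (by positivity)
  -- The first summand serves `exp s ≥ 2A`; for smaller `s` the second makes the right side at least
  -- 1.
  refine ⟨δ, hδ0, M * Real.exp (3 / 2) + Real.exp (δ * (1 + Real.log 2 / a₀)), ?_, ?_⟩
  · have : (1 : ℝ) ≤ Real.exp (3 / 2) := Real.one_le_exp (by norm_num)
    nlinarith [Real.exp_pos (δ * (1 + Real.log 2 / a₀))]
  intro E L r A hL hr hA hmod hsupp s hs0
  have hA1 : 1 < A := hA₀.trans_le hA
  have haa : a₀ ≤ Real.log A := Real.log_le_log (by linarith) hA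
  have ha : 0 < Real.log A := ha₀pos.trans_le haa
  have hr1 : 1 ≤ r ^ d := one_le_pow₀ hr
  set P := iidLaw d μ {ω | ENNReal.ofReal (Real.exp s) ≤ resolventNorm lam u ω (cube L 0) E}
    with hP
  have hP1 : P.toReal ≤ 1 := by
    simpa using ENNReal.toReal_mono ENNReal.one_ne_top (prob_le_one (μ := iidLaw d μ))
  rw [ENNReal.le_ofReal_iff_toReal_le (measure_ne_top _ _) (by positivity), add_mul]
  by_cases hs : 2 * A ≤ Real.exp s
  · refine le_add_of_le_of_nonneg ?_ (by positivity)
    have h := le_exp_of_le_one_of_le ENNReal.toReal_nonneg hP1 hM (by norm_num) ha₀pos haa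
      (iidLaw_le_resolventNorm_le hlam hB hu μ hK hρs hμ hL hr hA1.le hmod hsupp hs)
    refine h.trans_eq ?_
    congr 3
    rw [hδ, hc]
    field_simp
  · refine le_add_of_nonneg_of_le (by positivity) (hP1.trans ?_)
    rw [← Real.exp_add]
    refine Real.one_le_exp ?_
    rw [not_le, ← Real.lt_log_iff_exp_lt (by linarith), Real.log_mul two_ne_zero (by linarith)] at hs
    have h1 : s / (Real.log A * r ^ d) ≤ 1 + Real.log 2 / a₀ :=
      calc s / (Real.log A * r ^ d) ≤ s / Real.log A :=
            div_le_div_of_nonneg_left hs0 ha (le_mul_of_one_le_right ha.le hr1)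
        _ ≤ (Real.log 2 + Real.log A) / Real.log A := by gcongr
        _ = 1 + Real.log 2 / Real.log A := by field_simp; ring
        _ ≤ 1 + Real.log 2 / a₀ := by
          have := Real.log_nonneg (one_le_two (α := ℝ))
          gcongr
    rw [mul_div_assoc]
    nlinarith

end AlloyType

/-! ### The two probability bounds -/

theorem mainTheorem10 (d : ℕ) (hd : 1 ≤ d) (lam : ℝ) (hlam : 0 < lam)
    (u : (Fin d → ℤ) → ℝ)
    (μ : Measure ℝ) [IsProbabilityMeasure μ] (ρ : ℝ → ℝ) (hρm : Measurable ρ)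
    (hρ0 : ∀ x, 0 ≤ ρ x) (hρb : ∃ K : ℝ, ∀ x, ρ x ≤ K)
    (hρs : Function.support ρ ⊆ Set.Icc (-1 : ℝ) 1)
    (hμ : μ = volume.withDensity fun x => ENNReal.ofReal (ρ x))
    (A₀ : ℝ) (hA₀ : 1 < A₀) :
    ∃ δ : ℝ, 0 < δ ∧ ∃ C : ℝ, 0 < C ∧
      ∀ E L r A : ℝ, 0 < L → 1 ≤ r → A₀ ≤ A →
        AlloyType.RemovalBound lam u μ E L r A →
        AlloyType.ModificationBound lam u μ E L A →
        Function.support u ⊆ (AlloyType.cube r (0 : Fin d → ℤ) : Set (Fin d → ℤ)) →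
        (∀ s : ℝ,
          AlloyType.iidLaw d μ
              {ω | ENNReal.ofReal (Real.exp s) ≤
                AlloyType.resolventNorm lam u ω (AlloyType.cube L 0) E} ≤
            ENNReal.ofReal
              (C * (2 * L + 1) ^ d * Real.exp (-(δ * s / (Real.log A * r ^ d))))) ∧
        (∀ s : ℝ, C * r ^ d * Real.log A * Real.log (L + 2) ≤ s →
          AlloyType.iidLaw d μ
              {ω | ENNReal.ofReal (Real.exp s) ≤
                AlloyType.resolventNorm lam u ω (AlloyType.cube L 0) E} ≤
            ENNReal.ofReal (Real.exp (-(δ * s / (Real.log A * r ^ d))))) := by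
  obtain ⟨K, hK⟩ := hρb
  have hprob : IsProbabilityMeasure (AlloyType.iidLaw d μ) := by
    unfold AlloyType.iidLaw; infer_instance
  -- The constants precede `r`, so the bound on `u` needs finite support here; with infinite support
  -- no `r` is admissible.
  by_cases hfin : (Function.support u).Finite
  swap
  · exact ⟨1, one_pos, 1, one_pos, fun E L r A _ _ _ _ _ hsupp =>
      absurd ((Finset.finite_toSet _).subset hsupp) hfin⟩
  have hBex : ∃ B : ℝ, 0 ≤ B ∧ ∀ x, |u x| ≤ B := by
    refine ⟨∑ y ∈ hfin.toFinset, |u y|, Finset.sum_nonneg fun y _ => abs_nonneg _, fun x => ?_⟩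
    by_cases hx : u x = 0
    · rw [hx, abs_zero]
      exact Finset.sum_nonneg fun y _ => abs_nonneg _
    · exact Finset.single_le_sum (f := fun y => |u y|) (fun y _ => abs_nonneg _)
        (hfin.mem_toFinset.2 hx)
  obtain ⟨B, hB, hu⟩ := hBex
  obtain ⟨δ, hδ, C, hC, h⟩ :=
    AlloyType.exists_iidLaw_le_resolventNorm_le d hlam hB hu μ hK hρs hμ hA₀
  have hlog2 : 0 < Real.log 2 := Real.log_pos one_lt_two
  have hlogC : 0 ≤ Real.log C := Real.log_nonneg hC
  -- Chosen so that `X ≥ C' log 2`, with `X = s / (log A · r^d)`, gives `C ≤ exp (δ X / 2)`: half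
  -- the rate pays for `C`.
  set C' := C + 2 * Real.log C / (δ * Real.log 2) with hC'
  have hCC' : C ≤ C' := le_add_of_nonneg_right (by positivity)
  refine ⟨δ / 2, by positivity, C', by linarith, ?_⟩
  intro E L r A hL hr hA _ hmod hsupp
  have hC'0 : 0 < C' := by linarith
  have ha : 0 < Real.log A := Real.log_pos (hA₀.trans_le hA)
  have hrd : 0 < r ^ d := by positivity
  have hD : 0 < Real.log A * r ^ d := by positivity
  have hLd : 1 ≤ (2 * L + 1) ^ d := one_le_pow₀ (by linarith)
  have hCL : C ≤ C' * (2 * L + 1) ^ d := by nlinarith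
  refine ⟨fun s => ?_, fun s hs => ?_⟩
  · rcases le_or_gt 0 s with hs | hs
    · refine (h E L r A hL hr hA hmod hsupp s hs).trans (ENNReal.ofReal_le_ofReal ?_)
      have : δ / 2 * s ≤ δ * s := by nlinarith
      gcongr
    · refine prob_le_one.trans ?_
      rw [ENNReal.one_le_ofReal]
      have h1 : 1 ≤ Real.exp (-(δ / 2 * s / (Real.log A * r ^ d))) := by
        refine Real.one_le_exp ?_
        rw [← neg_div]
        exact div_nonneg (by nlinarith) hD.le
      nlinarith
  · have hlogL : Real.log 2 ≤ Real.log (L + 2) := Real.log_le_log two_pos (by linarith)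
    set X := s / (Real.log A * r ^ d) with hX
    have hXge : C' * Real.log 2 ≤ X := by
      rw [hX, le_div_iff₀ hD]
      refine le_trans ?_ hs
      have : 0 ≤ C' * (Real.log A * r ^ d) := by positivity
      nlinarith
    have hs0 : 0 ≤ s := 
      (mul_nonneg (by positivity) (hlog2.le.trans hlogL)).trans hs
    refine (h E L r A hL hr hA hmod hsupp s hs0).trans (ENNReal.ofReal_le_ofReal ?_)
    rw [mul_div_assoc, mul_div_assoc, ← hX]
    have hkey : Real.log C ≤ δ / 2 * X :=
      calc Real.log C = δ / 2 * (2 * Real.log C / (δ * Real.log 2) * Real.log 2) := by field_simp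
        _ ≤ δ / 2 * (C' * Real.log 2) := by
          gcongr
          linarith
        _ ≤ δ / 2 * X := by gcongr
    calc C * Real.exp (-(δ * X)) = Real.exp (Real.log C + -(δ * X)) := by
          rw [Real.exp_add, Real.exp_log (by linarith)]
      _ ≤ Real.exp (-(δ / 2 * X)) := Real.exp_le_exp.2 (by linarith)
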